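/- **Setting.** Featherweight Java (FJ) expressions are $e ::= x \mid \mathtt{this} \mid e.f \mid e.m(\bar e) \mid \mathtt{new}\ C(\bar e) \mid (C)e$. A class table $CT$ is a finite set of clauses $C\ \mathtt{extends}\ D$, $C.init(\bar C)$, $C.f : C'$, $C.m : \bar C \to C'$; $ext(CT)=\{(C,D) \mid (C\ \mathtt{extends}\ D)\in CT\}$, and for a finite relation $\Sigma$ on class names $<:_\Sigma$ is its reflexive transitive closure. Lookups: $fields(C,CT)=C.init(\bar D)$ if this constructor clause is in $CT$; $field(f,C,CT)$ and $mtype(m,C,CT)$ are read from the clause for $f$ (resp. $m$) in $C$ or, if $C$ has none, are inherited from a direct superclass of $C$. The judgment $\Gamma;CT\vdash e:C$ is FJ expression typing with these lookups and with subtyping $<:_{ext(CT)}$ (rules for variables, field access, invocation, object creation, and up-, down- and stupid casts). *Class types* are $T ::= C \mid U$ with $U$ a class variable. *Context requirements* $R$ are finite sets of bindings $x:T$. *Class table requirements* $CR$ are finite sets of pairs $(CReq, cond)$ with $CReq$ one of $T.\mathtt{extends}:T'$, $T.init(\bar T)$, $T.f:T'$, $T.m:\bar T\to T'$, $(T.m:\bar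 T\to T')_{opt}$, and $cond$ a finite set of equalities and inequalities between class types. Constraints are $T=T'$, $T\ne T'$, $T<:T'$, $T\not<:T'$, and conditional equalities of types or of type sequences. $merge_R(R_1,R_2)$ is $R_1$ together with the bindings in $R_2$ of variables outside $dom(R_1)$, and yields the constraints $R_1(x)=R_2(x)$ for common $x$. $merge_{CR}(CR_1,CR_2)$ keeps each requirement that has no requirement of the same kind and member name on the other side; each pair $(r_1,cond_1)\in CR_1$, $(r_2,cond_2)\in CR_2$ of the same kind and member name, with receivers $T_1,T_2$, is replaced by $(r_1,cond_1\cup\{T_1\neq T_2\})$, $(r_2,cond_2\cup\{T_1\ne T_2\})$, $(r_1,cond_1\cup cond_2\cup\{T_1=T_2\})$ and yields the constraints that the remaining types of $r_1$ and $r_2$ are equal if $T_1=T_2$. Merges of several sets are iterated from left to right. The co-contextual judgment $e : T \mid S\mid R\mid CR$ is given by the following rules, where all class variables introduced are fresh and independent subderivations use disjoint sets of class variables; $S$ always contains the constraints of the premises and of the merges. * $x : U\mid\emptyset\mid\{x:U\}\mid\emptyset$ (also for $\mathtt{this}$). * If $e:T_e\mid S_e\mid R_e\mid CR_e$, then $e.f$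 has type $U$, context requirements $R_e$, and class table requirements $merge_{CR}(CR_e,\{(T_e.f:U,\emptyset)\})$. * If $e:T_e\mid S_e\mid R_e\mid CR_e$ and $\bar e:\bar T\mid\bar S\mid\bar R\mid\overline{CR}$, then $e.m(\bar e)$ has type $U'$, requirements $merge_R(R_e,\bar R)$ and $merge_{CR}(CR_e,\{(T_e.m:\bar U\to U',\emptyset)\},\overline{CR})$, and the further constraints $\bar T<:\bar U$. * If $\bar e:\bar T\mid\bar S\mid\bar R\mid\overline{CR}$, then $\mathtt{new}\ C(\bar e)$ has type $C$, requirements $merge_R(\bar R)$ and $merge_{CR}(\{(C.init(\bar U),\emptyset)\},\overline{CR})$, and the further constraints $\bar T<:\bar U$. * If $e:T_e\mid S_e\mid R_e\mid CR_e$, then $(C)e$ has type $C$, requirements $R_e$, $CR_e$, and further constraints $\{T_e<:C\}$, or $\{C<:T_e,\ C\neq T_e\}$, or $\{C\not<:T_e,\ T_e\not<:C\}$. A substitution $\sigma$ maps class variables to class types. $solve(\Sigma,S)=\sigma$ means that every constraint in $S$ holds after applying $\sigma$, with subtyping read as $<:_\Sigma$ on class names. It is a *ground solution* if no class variable occurs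 in $\sigma(T)$, $\sigma(R)$, $\sigma(CR)$. $CT$ *satisfies* a ground $CR$ if for every $(CReq,cond)\in CR$ whose $cond$ holds: $CT$ contains the required extends clause; $fields$, $field$ or $mtype$ in $CT$ returns the required types; or, for an optional method requirement, every result of $mtype$ is the required signature. **Theorem.** Let $e : T\mid S\mid R\mid CR$, let $\Sigma$ be a finite binary relation on class names, and let $solve(\Sigma,S)=\sigma$ be a ground solution. Then there are a class name $C$, a typing context $\Gamma$ (a finite set of bindings, at most one for each variable) and a class table $CT$ such that 1. $\Gamma;CT\vdash e:C$; 2. $C=\sigma(T)$, $\Gamma\supseteq\sigma(R)$, and $CT$ satisfies $\sigma(CR)$; 3. $ext(CT)=\Sigma$. Moreover, $CT$ can be built from the ground requirements: each of its clauses is an extends clause for a pair in $\Sigma$ or is the clause corresponding to a requirement in $\sigma(CR)$, and each constructor, field and method of a class has at most one clause in $CT$. -/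

import Mathlib

namespace CoFJ

/-! ### Syntax of Featherweight Java expressions -/

abbrev ClassName := String
abbrev FieldName := String
abbrev MethodName := String

/-- Term variables: the self reference `this` and the method parameters. -/
inductive Var where
  | this : Var
  | param : String → Var
  deriving DecidableEq

inductive Expr where
  | var : Var → Expr
  | field : Expr → FieldName → Expr
  | invk : Expr → MethodName → List Expr → Expr
  | new : ClassName → List Expr → Expr
  | cast : ClassName → Expr → Expr

/-- Typing contexts: finite sets of bindings, at most one for each variable. -/
structure Ctx where
  bindings : Finset (Var × ClassName)
  functional : ∀ x C D, (x, C) ∈ bindings → (x, D) ∈ bindings → C = D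

/-! ### Class tables -/

/-- Class table clauses `C extends D`, `C.init(C̄)`, `C.f : C'`, `C.m : C̄ → C'`. -/
inductive Clause where
  | ext : ClassName → ClassName → Clause
  | ctor : ClassName → List ClassName → Clause
  | field : ClassName → FieldName → ClassName → Clause
  | method : ClassName → MethodName → List ClassName → ClassName → Clause
  deriving DecidableEq

/-- What a clause defines: `C.extends`, `C.init`, `C.f` or `C.m`. -/
inductive ClauseDom where
  | ext : ClassName → ClauseDom
  | ctor : ClassName → ClauseDom
  | field : ClassName → FieldName → ClauseDom
  | method : ClassName → MethodName → ClauseDom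
  deriving DecidableEq

def Clause.dom : Clause → ClauseDom
  | .ext C _ => .ext C
  | .ctor C _ => .ctor C
  | .field C f _ => .field C f
  | .method C m _ _ => .method C m

/-- A class table is a finite collection of clauses. -/
abbrev ClassTable := Finset Clause

/-- A (finite) immediate subclass relation. -/
abbrev SubclassRel := Finset (ClassName × ClassName)

/-- The projection of a class table to its immediate subclass relation. -/
def ClassTable.extRel (CT : ClassTable) : SubclassRel :=
  CT.biUnion fun c => match c with
    | .ext C D => {(C, D)}
    | _ => ∅

/-- Constructors, fields and methods are declared at most once in each class. (That a class has at
most one superclass is a property of `CT.extRel` alone.) -/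
def ClassTable.Coherent (CT : ClassTable) : Prop :=
  ∀ c ∈ CT, ∀ c' ∈ CT, (∀ C, c.dom ≠ .ext C) → c.dom = c'.dom → c = c'

/-- Subtyping relative to `Sig`: the reflexive transitive closure. -/
def IsSubtype (Sig : SubclassRel) (C D : ClassName) : Prop :=
  Relation.ReflTransGen (fun A B => (A, B) ∈ Sig) C D

/-- `fields(C, CT) = C.init(D̄)`: the constructor signature of `C`. -/
def Fields (CT : ClassTable) (C : ClassName) (Ds : List ClassName) : Prop :=
  Clause.ctor C Ds ∈ CT

/-- `field(f, C, CT) = C'`: the declaration of `f` in `C`, or else in the nearest superclass. -/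
inductive FieldLookup (CT : ClassTable) (f : FieldName) : ClassName → ClassName → Prop
  | here {C C' : ClassName} : Clause.field C f C' ∈ CT → FieldLookup CT f C C'
  | inherit {C D C' : ClassName} : (∀ B, Clause.field C f B ∉ CT) → Clause.ext C D ∈ CT →
      FieldLookup CT f D C' → FieldLookup CT f C C'

/-- `mtype(m, C, CT) = C̄ → C'`: the declaration of `m` in `C`, or else in the nearest
superclass. -/
inductive MType (CT : ClassTable) (m : MethodName) :
    ClassName → List ClassName → ClassName → Prop
  | here {C : ClassName} {Cs : List ClassName} {C' : ClassName} :
      Clause.method C m Cs C' ∈ CT → MType CT m C Cs C'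
  | inherit {C D : ClassName} {Cs : List ClassName} {C' : ClassName} :
      (∀ Bs B, Clause.method C m Bs B ∉ CT) → Clause.ext C D ∈ CT →
      MType CT m D Cs C' → MType CT m C Cs C'

/-! ### The contextual type system -/

mutual

/-- `Γ; CT ⊢ e : C`. -/
inductive HasType (Γ : Ctx) (CT : ClassTable) : Expr → ClassName → Prop
  | var {x : Var} {C : ClassName} : (x, C) ∈ Γ.bindings → HasType Γ CT (.var x) C
  | field {e : Expr} {f : FieldName} {Ce C : ClassName} :
      HasType Γ CT e Ce → FieldLookup CT f Ce C → HasType Γ CT (.field e f) C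
  | invk {e : Expr} {m : MethodName} {es : List Expr} {Ce C : ClassName}
      {Cs Ds : List ClassName} :
      HasType Γ CT e Ce → HasTypes Γ CT es Cs → MType CT m Ce Ds C →
      List.Forall₂ (IsSubtype CT.extRel) Cs Ds → HasType Γ CT (.invk e m es) C
  | new {C : ClassName} {es : List Expr} {Cs Ds : List ClassName} :
      HasTypes Γ CT es Cs → Fields CT C Ds →
      List.Forall₂ (IsSubtype CT.extRel) Cs Ds → HasType Γ CT (.new C es) C
  | ucast {C D : ClassName} {e : Expr} :
      HasType Γ CT e D → IsSubtype CT.extRel D C → HasType Γ CT (.cast C e) C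
  | dcast {C D : ClassName} {e : Expr} :
      HasType Γ CT e D → IsSubtype CT.extRel C D → C ≠ D → HasType Γ CT (.cast C e) C
  | scast {C D : ClassName} {e : Expr} :
      HasType Γ CT e D → ¬ IsSubtype CT.extRel C D → ¬ IsSubtype CT.extRel D C →
      HasType Γ CT (.cast C e) C

/-- `Γ; CT ⊢ ē : C̄`, pointwise. -/
inductive HasTypes (Γ : Ctx) (CT : ClassTable) : List Expr → List ClassName → Prop
  | nil : HasTypes Γ CT [] []
  | cons {e : Expr} {es : List Expr} {C : ClassName} {Cs : List ClassName} :
      HasType Γ CT e C → HasTypes Γ CT es Cs → HasTypes Γ CT (e :: es) (C :: Cs)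

end

/-! ### Class types, conditions, constraints and requirements -/

/-- Class variables. -/
abbrev CVar := ℕ

/-- Class types: class names and class variables. -/
inductive Ty where
  | cls : ClassName → Ty
  | var : CVar → Ty
  deriving DecidableEq

/-- Substitutions; a class variable that is not bound is mapped to itself. -/
abbrev Subst := CVar → Ty

def Ty.subst (σ : Subst) : Ty → Ty
  | .cls C => .cls C
  | .var U => σ U

def Ty.Ground (T : Ty) : Prop := ∃ C, T = .cls C

inductive CondAtom where
  | eq : Ty → Ty → CondAtom
  | ne : Ty → Ty → CondAtom
  deriving DecidableEq

def CondAtom.subst (σ : Subst) : CondAtom → CondAtom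
  | .eq T T' => .eq (T.subst σ) (T'.subst σ)
  | .ne T T' => .ne (T.subst σ) (T'.subst σ)

def CondAtom.Ground : CondAtom → Prop
  | .eq T T' => T.Ground ∧ T'.Ground
  | .ne T T' => T.Ground ∧ T'.Ground

def CondAtom.Holds : CondAtom → Prop
  | .eq T T' => T = T'
  | .ne T T' => T ≠ T'

/-- Conditions: conjunctions of equalities and inequalities. -/
abbrev Cond := Finset CondAtom

def Cond.subst (σ : Subst) (c : Cond) : Cond := c.image (CondAtom.subst σ)

def Cond.Holds (c : Cond) : Prop := ∀ a ∈ c, a.Holds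

/-- Constraints. `seqEqIf` is the conditional equality of two sequences of class types, which
includes that they have the same length. -/
inductive Constraint where
  | eq : Ty → Ty → Constraint
  | ne : Ty → Ty → Constraint
  | sub : Ty → Ty → Constraint
  | nsub : Ty → Ty → Constraint
  | eqIf : Ty → Ty → Cond → Constraint
  | seqEqIf : List Ty → List Ty → Cond → Constraint
  deriving DecidableEq

/-- Subtyping relative to `Sig` on class types: both are class names, in the relation. -/
def TySubtype (Sig : SubclassRel) (T T' : Ty) : Prop :=
  ∃ C D, T = .cls C ∧ T' = .cls D ∧ IsSubtype Sig C D

/-- Constraint satisfaction by `(Sig, σ)`. -/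
def Sat (Sig : SubclassRel) (σ : Subst) : Constraint → Prop
  | .eq T T' => T.subst σ = T'.subst σ
  | .ne T T' => T.subst σ ≠ T'.subst σ
  | .sub T T' => TySubtype Sig (T.subst σ) (T'.subst σ)
  | .nsub T T' => ¬ TySubtype Sig (T.subst σ) (T'.subst σ)
  | .eqIf T T' c => (c.subst σ).Holds → T.subst σ = T'.subst σ
  | .seqEqIf Ts Ts' c => (c.subst σ).Holds → Ts.map (Ty.subst σ) = Ts'.map (Ty.subst σ)

abbrev ConstraintSet := Finset Constraint

/-- `σ` is a solution of `S` relative to `Sig`. -/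
def Solves (Sig : SubclassRel) (S : ConstraintSet) (σ : Subst) : Prop :=
  ∀ s ∈ S, Sat Sig σ s

/-- Class requirements `T.extends : T'`, `T.init(T̄)`, `T.f : T'`, `T.m : T̄ → T'` and
`(T.m : T̄ → T')_opt`. -/
inductive CReq where
  | ext : Ty → Ty → CReq
  | ctor : Ty → List Ty → CReq
  | field : Ty → FieldName → Ty → CReq
  | method : Ty → MethodName → List Ty → Ty → CReq
  | optMethod : Ty → MethodName → List Ty → Ty → CReq
  deriving DecidableEq

def CReq.subst (σ : Subst) : CReq → CReq
  | .ext T T' => .ext (T.subst σ) (T'.subst σ)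
  | .ctor T Ts => .ctor (T.subst σ) (Ts.map (Ty.subst σ))
  | .field T f T' => .field (T.subst σ) f (T'.subst σ)
  | .method T m Ts T' => .method (T.subst σ) m (Ts.map (Ty.subst σ)) (T'.subst σ)
  | .optMethod T m Ts T' => .optMethod (T.subst σ) m (Ts.map (Ty.subst σ)) (T'.subst σ)

def CReq.Ground : CReq → Prop
  | .ext T T' => T.Ground ∧ T'.Ground
  | .ctor T Ts => T.Ground ∧ ∀ A ∈ Ts, A.Ground
  | .field T _ T' => T.Ground ∧ T'.Ground
  | .method T _ Ts T' => T.Ground ∧ (∀ A ∈ Ts, A.Ground) ∧ T'.Ground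
  | .optMethod T _ Ts T' => T.Ground ∧ (∀ A ∈ Ts, A.Ground) ∧ T'.Ground

/-- The receiver type of a requirement. -/
def CReq.recv : CReq → Ty
  | .ext T _ => T
  | .ctor T _ => T
  | .field T _ _ => T
  | .method T _ _ _ => T
  | .optMethod T _ _ _ => T

/-- Class table requirements: finite sets of conditional class requirements. -/
abbrev CTReq := Finset (CReq × Cond)

def CTReq.subst (σ : Subst) (CR : CTReq) : CTReq :=
  CR.image fun p => (p.1.subst σ, p.2.subst σ)

def CTReq.Ground (CR : CTReq) : Prop :=
  ∀ p ∈ CR, p.1.Ground ∧ ∀ a ∈ p.2, a.Ground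

/-- Context requirements: finite sets of bindings of variables to class types. -/
abbrev CtxReq := Finset (Var × Ty)

def CtxReq.subst (σ : Subst) (R : CtxReq) : CtxReq :=
  R.image fun b => (b.1, b.2.subst σ)

def CtxReq.Ground (R : CtxReq) : Prop := ∀ b ∈ R, b.2.Ground

/-! ### Merging requirements -/

/-- `R` together with the bindings of `R'` of variables outside the domain of `R`; the types of
the common variables are equated. -/
def mergeR (R R' : CtxReq) : CtxReq × ConstraintSet :=
  (R ∪ R'.filter (fun b => b.1 ∉ R.image Prod.fst),
   (R ×ˢ R').biUnion fun p => if p.1.1 = p.2.1 then {.eq p.1.2 p.2.2} else ∅)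

/-- The merge of a sequence of context requirements, from left to right. -/
def mergeRs (Rs : List CtxReq) : CtxReq × ConstraintSet :=
  Rs.foldl (fun acc R => ((mergeR acc.1 R).1, acc.2 ∪ (mergeR acc.1 R).2)) (∅, ∅)

/-- Two requirements overlap if they are of the same kind and about the same field or method
name. -/
def CReq.overlap : CReq → CReq → Bool
  | .ext _ _, .ext _ _ => true
  | .ctor _ _, .ctor _ _ => true
  | .field _ f _, .field _ g _ => decide (f = g)
  | .method _ m _ _, .method _ n _ _ => decide (m = n)
  | .optMethod _ m _ _, .optMethod _ n _ _ => decide (m = n)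
  | _, _ => false

/-- The requirements that replace two overlapping requirements. -/
def mergeReqPair (p q : CReq × Cond) : CTReq :=
  {(p.1, insert (.ne p.1.recv q.1.recv) p.2),
   (q.1, insert (.ne p.1.recv q.1.recv) q.2),
   (p.1, insert (.eq p.1.recv q.1.recv) (p.2 ∪ q.2))}

/-- The constraints that two overlapping requirements generate. -/
def mergeReqConstraints : CReq → CReq → ConstraintSet
  | .ext T₁ T₁', .ext T₂ T₂' => {.eqIf T₁' T₂' {.eq T₁ T₂}}
  | .ctor T₁ Ts₁, .ctor T₂ Ts₂ => {.seqEqIf Ts₁ Ts₂ {.eq T₁ T₂}}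
  | .field T₁ _ T₁', .field T₂ _ T₂' => {.eqIf T₁' T₂' {.eq T₁ T₂}}
  | .method T₁ _ Ts₁ T₁', .method T₂ _ Ts₂ T₂' =>
      {.eqIf T₁' T₂' {.eq T₁ T₂}, .seqEqIf Ts₁ Ts₂ {.eq T₁ T₂}}
  | .optMethod T₁ _ Ts₁ T₁', .optMethod T₂ _ Ts₂ T₂' =>
      {.eqIf T₁' T₂' {.eq T₁ T₂}, .seqEqIf Ts₁ Ts₂ {.eq T₁ T₂}}
  | _, _ => ∅

/-- `merge_CR(CR, CR')`: requirements without an overlapping one on the other side are kept, each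
pair of overlapping requirements is replaced. -/
def mergeCR (CR CR' : CTReq) : CTReq × ConstraintSet :=
  (CR.filter (fun p => ∀ q ∈ CR', p.1.overlap q.1 = false) ∪
     CR'.filter (fun q => ∀ p ∈ CR, p.1.overlap q.1 = false) ∪
     (CR ×ˢ CR').biUnion (fun pq =>
       if pq.1.1.overlap pq.2.1 = true then mergeReqPair pq.1 pq.2 else ∅),
   (CR ×ˢ CR').biUnion fun pq =>
     if pq.1.1.overlap pq.2.1 = true then mergeReqConstraints pq.1.1 pq.2.1 else ∅)

/-- The merge of a sequence of class table requirements, from left to right. -/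
def mergeCRs (CRs : List CTReq) : CTReq × ConstraintSet :=
  CRs.foldl (fun acc CR => ((mergeCR acc.1 CR).1, acc.2 ∪ (mergeCR acc.1 CR).2)) (∅, ∅)

/-! ### The co-contextual type system -/

/-- The constraints `T̄ <: Ū` between sequences of the same length. -/
def subConstraints (Ts : List Ty) (Us : List CVar) : ConstraintSet :=
  (List.zipWith (fun T U => Constraint.sub T (.var U)) Ts Us).toFinset

mutual

/-- `e : T | S | R | CR`. The first index is the set of class variables that the derivation has
introduced; it only serves to express that variables are chosen fresh and that independent
derivations use disjoint sets of variables. -/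
inductive CoType : Finset CVar → Expr → Ty → ConstraintSet → CtxReq → CTReq → Prop
  | var {x : Var} {U : CVar} : CoType {U} (.var x) (.var U) ∅ {(x, .var U)} ∅
  | field {F : Finset CVar} {e : Expr} {f : FieldName} {Te : Ty} {Se : ConstraintSet}
      {Re : CtxReq} {CRe CR : CTReq} {Sf : ConstraintSet} {U : CVar} :
      CoType F e Te Se Re CRe → U ∉ F →
      (CR, Sf) = mergeCR CRe {(.field Te f (.var U), ∅)} →
      CoType (insert U F) (.field e f) (.var U) (Se ∪ Sf) Re CR
  | invk {Fe Fs : Finset CVar} {e : Expr} {m : MethodName} {es : List Expr} {Te : Ty}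
      {Ts : List Ty} {Se Ss Sr Scr : ConstraintSet} {Re R : CtxReq} {Rs : List CtxReq}
      {CRe CR : CTReq} {CRs : List CTReq} {U : CVar} {Us : List CVar} :
      CoType Fe e Te Se Re CRe → CoTypes Fs es Ts Ss Rs CRs → Disjoint Fe Fs →
      Us.length = es.length → (U :: Us).Nodup → (∀ V ∈ U :: Us, V ∉ Fe ∪ Fs) →
      (R, Sr) = mergeRs (Re :: Rs) →
      (CR, Scr) = mergeCRs (CRe :: {(.method Te m (Us.map Ty.var) (.var U), ∅)} :: CRs) →
      CoType (Fe ∪ Fs ∪ (U :: Us).toFinset) (.invk e m es) (.var U)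
        (Ss ∪ Se ∪ subConstraints Ts Us ∪ Sr ∪ Scr) R CR
  | new {Fs : Finset CVar} {C : ClassName} {es : List Expr} {Ts : List Ty}
      {Ss Sr Scr : ConstraintSet} {R : CtxReq} {Rs : List CtxReq} {CR : CTReq}
      {CRs : List CTReq} {Us : List CVar} :
      CoTypes Fs es Ts Ss Rs CRs →
      Us.length = es.length → Us.Nodup → (∀ V ∈ Us, V ∉ Fs) →
      (R, Sr) = mergeRs Rs →
      (CR, Scr) = mergeCRs ({(.ctor (.cls C) (Us.map Ty.var), ∅)} :: CRs) →
      CoType (Fs ∪ Us.toFinset) (.new C es) (.cls C)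
        (Ss ∪ subConstraints Ts Us ∪ Sr ∪ Scr) R CR
  | ucast {F : Finset CVar} {C : ClassName} {e : Expr} {Te : Ty} {Se : ConstraintSet}
      {Re : CtxReq} {CRe : CTReq} :
      CoType F e Te Se Re CRe →
      CoType F (.cast C e) (.cls C) (Se ∪ {.sub Te (.cls C)}) Re CRe
  | dcast {F : Finset CVar} {C : ClassName} {e : Expr} {Te : Ty} {Se : ConstraintSet}
      {Re : CtxReq} {CRe : CTReq} :
      CoType F e Te Se Re CRe →
      CoType F (.cast C e) (.cls C) (Se ∪ {.sub (.cls C) Te} ∪ {.ne (.cls C) Te}) Re CRe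
  | scast {F : Finset CVar} {C : ClassName} {e : Expr} {Te : Ty} {Se : ConstraintSet}
      {Re : CtxReq} {CRe : CTReq} :
      CoType F e Te Se Re CRe →
      CoType F (.cast C e) (.cls C) (Se ∪ {.nsub (.cls C) Te} ∪ {.nsub Te (.cls C)}) Re CRe

/-- Independent derivations for the expressions of a sequence; the constraint sets are united,
the requirements are kept apart. -/
inductive CoTypes : Finset CVar → List Expr → List Ty → ConstraintSet → List CtxReq →
    List CTReq → Prop
  | nil : CoTypes ∅ [] [] ∅ [] []
  | cons {F Fs : Finset CVar} {e : Expr} {es : List Expr} {T : Ty} {Ts : List Ty}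
      {S Ss : ConstraintSet} {R : CtxReq} {Rs : List CtxReq} {CR : CTReq} {CRs : List CTReq} :
      CoType F e T S R CR → CoTypes Fs es Ts Ss Rs CRs → Disjoint F Fs →
      CoTypes (F ∪ Fs) (e :: es) (T :: Ts) (S ∪ Ss) (R :: Rs) (CR :: CRs)

end

/-- The co-contextual typing judgment `e : T | S | R | CR`. -/
def CoTyping (e : Expr) (T : Ty) (S : ConstraintSet) (R : CtxReq) (CR : CTReq) : Prop :=
  ∃ F, CoType F e T S R CR

/-! ### Correspondence -/

/-- `σ(T)`, `σ(R)` and `σ(CR)` are ground. -/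
def GroundSolution (σ : Subst) (T : Ty) (R : CtxReq) (CR : CTReq) : Prop :=
  (T.subst σ).Ground ∧ (R.subst σ).Ground ∧ (CR.subst σ).Ground

/-- A class table satisfies a (ground) class requirement. -/
inductive SatisfiesReq (CT : ClassTable) : CReq → Prop
  | ext {C D : ClassName} : Clause.ext C D ∈ CT → SatisfiesReq CT (.ext (.cls C) (.cls D))
  | ctor {C : ClassName} {Ds : List ClassName} : Fields CT C Ds →
      SatisfiesReq CT (.ctor (.cls C) (Ds.map Ty.cls))
  | field {C C' : ClassName} {f : FieldName} : FieldLookup CT f C C' →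
      SatisfiesReq CT (.field (.cls C) f (.cls C'))
  | method {C C' : ClassName} {m : MethodName} {Ds : List ClassName} : MType CT m C Ds C' →
      SatisfiesReq CT (.method (.cls C) m (Ds.map Ty.cls) (.cls C'))
  | optMethod {C C' : ClassName} {m : MethodName} {Ds : List ClassName} :
      (∀ Es E, MType CT m C Es E → Es = Ds ∧ E = C') →
      SatisfiesReq CT (.optMethod (.cls C) m (Ds.map Ty.cls) (.cls C'))

/-- A class table satisfies class table requirements: every requirement whose condition holds. -/
def ClassTable.Satisfies (CT : ClassTable) (CR : CTReq) : Prop :=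
  ∀ p ∈ CR, p.2.Holds → SatisfiesReq CT p.1

/-- A typing context as a set of bindings of variables to class types. -/
def Ctx.toReq (Γ : Ctx) : CtxReq := Γ.bindings.image fun b => (b.1, Ty.cls b.2)

/-- The correspondence relation `(C, Γ, CT) ▷ σ(T, R, CR)`. -/
def Corresponds (C : ClassName) (Γ : Ctx) (CT : ClassTable) (σ : Subst) (T : Ty) (R : CtxReq)
    (CR : CTReq) : Prop :=
  Ty.cls C = T.subst σ ∧ R.subst σ ⊆ Γ.toReq ∧ CT.Satisfies (CR.subst σ)

/-- The class requirement that a class table clause translates to. -/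
def Clause.toReq : Clause → CReq
  | .ext C D => .ext (.cls C) (.cls D)
  | .ctor C Cs => .ctor (.cls C) (Cs.map Ty.cls)
  | .field C f C' => .field (.cls C) f (.cls C')
  | .method C m Cs C' => .method (.cls C) m (Cs.map Ty.cls) (.cls C')

/-- Apart from the extends clauses given by `Sig`, the class table consists of clauses that
translate ground requirements of `CR`. -/
def ClassTable.BuiltFrom (CT : ClassTable) (Sig : SubclassRel) (CR : CTReq) : Prop :=
  ∀ c ∈ CT, (∃ p ∈ Sig, c = Clause.ext p.1 p.2) ∨ ∃ p ∈ CR, p.1 = c.toReq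

end CoFJ

open CoFJ

namespace CoFJ

/-! ### Solutions -/

theorem Solves.mono {Sig : SubclassRel} {S S' : ConstraintSet} {σ : Subst}
    (h : Solves Sig S' σ) (hS : S ⊆ S') : Solves Sig S σ :=
  fun s hs => h s (hS hs)

theorem solves_union {Sig : SubclassRel} {S S' : ConstraintSet} {σ : Subst} :
    Solves Sig (S ∪ S') σ ↔ Solves Sig S σ ∧ Solves Sig S' σ :=
  ⟨fun h => ⟨h.mono Finset.subset_union_left, h.mono Finset.subset_union_right⟩,
    fun h s hs => (Finset.mem_union.1 hs).elim (h.1 s) (h.2 s)⟩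

/-! ### Merging context requirements -/

/-- At most one binding for each variable. -/
def CtxReq.Functional (R : CtxReq) : Prop :=
  ∀ b ∈ R, ∀ b' ∈ R, b.1 = b'.1 → b = b'

theorem mergeR_functional {R R' : CtxReq} (h : R.Functional) (h' : R'.Functional) :
    CtxReq.Functional (mergeR R R').1 := by
  intro b hb b' hb' e
  simp only [mergeR, Finset.mem_union, Finset.mem_filter, Finset.mem_image, not_exists,
    not_and] at hb hb'
  rcases hb with hb | hb <;> rcases hb' with hb' | hb'
  · exact h b hb b' hb' e
  · exact absurd e (hb'.2 b hb)
  · exact absurd e.symm (hb.2 b' hb')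
  · exact h' b hb.1 b' hb'.1 e

theorem subst_left_subset_mergeR (σ : Subst) (R R' : CtxReq) :
    R.subst σ ⊆ CtxReq.subst σ (mergeR R R').1 :=
  Finset.image_subset_image Finset.subset_union_left

theorem subst_right_subset_mergeR {Sig : SubclassRel} {σ : Subst} {R R' : CtxReq}
    (h : Solves Sig (mergeR R R').2 σ) :
    R'.subst σ ⊆ CtxReq.subst σ (mergeR R R').1 := by
  intro b hb
  obtain ⟨c, hc, rfl⟩ := Finset.mem_image.1 hb
  by_cases hx : c.1 ∈ R.image Prod.fst
  · obtain ⟨d, hd, hdc⟩ := Finset.mem_image.1 hx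
    have hs := h (.eq d.2 c.2) (Finset.mem_biUnion.2 ⟨(d, c), Finset.mk_mem_product hd hc, by
      simp [hdc]⟩)
    exact Finset.mem_image.2 ⟨d, Finset.mem_union_left _ hd, Prod.ext hdc hs⟩
  · exact Finset.mem_image.2
      ⟨c, Finset.mem_union_right _ (Finset.mem_filter.2 ⟨hc, hx⟩), rfl⟩

theorem foldl_mergeR_functional {Rs : List CtxReq} {acc : CtxReq × ConstraintSet}
    (hacc : acc.1.Functional) (hRs : ∀ R ∈ Rs, CtxReq.Functional R) :
    CtxReq.Functional (Rs.foldl (fun acc R =>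
      ((mergeR acc.1 R).1, acc.2 ∪ (mergeR acc.1 R).2)) acc).1 := by
  induction Rs generalizing acc with
  | nil => exact hacc
  | cons R Rs ih =>
    exact ih (mergeR_functional hacc (hRs R (by simp)))
      fun R' h' => hRs R' (List.mem_cons_of_mem _ h')

theorem mergeRs_functional {Rs : List CtxReq} (hRs : ∀ R ∈ Rs, CtxReq.Functional R) :
    CtxReq.Functional (mergeRs Rs).1 :=
  foldl_mergeR_functional (fun b hb => absurd hb (Finset.notMem_empty b)) hRs

theorem subset_foldl_mergeR {Sig : SubclassRel} {σ : Subst} {Rs : List CtxReq}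
    {acc : CtxReq × ConstraintSet}
    (h : Solves Sig (Rs.foldl (fun acc R =>
      ((mergeR acc.1 R).1, acc.2 ∪ (mergeR acc.1 R).2)) acc).2 σ) :
    Solves Sig acc.2 σ ∧ ∀ R ∈ acc.1 :: Rs, CtxReq.subst σ R ⊆ CtxReq.subst σ (Rs.foldl
      (fun acc R => ((mergeR acc.1 R).1, acc.2 ∪ (mergeR acc.1 R).2)) acc).1 := by
  induction Rs generalizing acc with
  | nil => exact ⟨h, by simp⟩
  | cons R Rs ih =>
    obtain ⟨hs, hsub⟩ := ih h
    obtain ⟨hs₁, hs₂⟩ := solves_union.1 hs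
    have hm := hsub _ List.mem_cons_self
    refine ⟨hs₁, fun R' hR' => ?_⟩
    rcases List.mem_cons.1 hR' with rfl | hR'
    · exact (subst_left_subset_mergeR σ _ _).trans hm
    rcases List.mem_cons.1 hR' with rfl | hR'
    · exact (subst_right_subset_mergeR hs₂).trans hm
    · exact hsub R' (List.mem_cons_of_mem _ hR')

theorem subset_mergeRs {Sig : SubclassRel} {σ : Subst} {Rs : List CtxReq}
    (h : Solves Sig (mergeRs Rs).2 σ) :
    ∀ R ∈ Rs, CtxReq.subst σ R ⊆ CtxReq.subst σ (mergeRs Rs).1 :=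
  fun R hR => (subset_foldl_mergeR h).2 R (List.mem_cons_of_mem _ hR)

/-! ### Active class table requirements -/

/-- `r` is an instance of a requirement of `CR` whose condition holds under `σ`. -/
def CTReq.Active (σ : Subst) (CR : CTReq) (r : CReq) : Prop :=
  ∃ p ∈ CR, (p.2.subst σ).Holds ∧ p.1.subst σ = r

/-- Two requirements concern the same member of the same class. -/
def CReq.SameMember (r r' : CReq) : Prop := r.overlap r' = true ∧ r.recv = r'.recv

/-- Requirements for constructors, fields and (non-optional) methods. -/
def CReq.IsMember : CReq → Prop
  | .ctor _ _ | .field _ _ _ | .method _ _ _ _ => True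
  | _ => False

theorem CReq.overlap_subst (σ : Subst) (r r' : CReq) :
    (r.subst σ).overlap (r'.subst σ) = r.overlap r' := by
  cases r <;> cases r' <;> rfl

theorem CReq.recv_subst (σ : Subst) (r : CReq) : (r.subst σ).recv = r.recv.subst σ := by
  cases r <;> rfl

theorem CReq.overlap_refl (r : CReq) : r.overlap r = true := by
  cases r <;> simp [CReq.overlap]

theorem CReq.overlap_comm (r r' : CReq) : r.overlap r' = r'.overlap r := by
  cases r <;> cases r' <;> simp [CReq.overlap, eq_comm]

theorem CReq.overlap_trans {r₁ r₂ r₃ : CReq} (h : r₁.overlap r₂ = true)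
    (h' : r₂.overlap r₃ = true) : r₁.overlap r₃ = true := by
  cases r₁ <;> cases r₂ <;> simp [CReq.overlap] at h <;> cases r₃ <;>
    simp_all [CReq.overlap]

theorem CReq.SameMember.refl (r : CReq) : r.SameMember r := ⟨r.overlap_refl, rfl⟩

theorem CReq.SameMember.symm {r r' : CReq} (h : r.SameMember r') : r'.SameMember r :=
  ⟨(CReq.overlap_comm _ _).trans h.1, h.2.symm⟩

theorem CReq.SameMember.trans {r₁ r₂ r₃ : CReq} (h : r₁.SameMember r₂)
    (h' : r₂.SameMember r₃) : r₁.SameMember r₃ :=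
  ⟨CReq.overlap_trans h.1 h'.1, h.2.trans h'.2⟩

theorem CReq.IsMember.subst {r : CReq} (h : r.IsMember) (σ : Subst) : (r.subst σ).IsMember := by
  cases r <;> exact h

/-- The invariants of the requirements of a derivation whose constraints are solved by `σ`: active
requirements on the same member agree, and each requirement has an active one on the same
member. -/
structure CTReq.WellFormed (σ : Subst) (CR : CTReq) : Prop where
  isMember : ∀ p ∈ CR, p.1.IsMember
  unique : ∀ r r', CTReq.Active σ CR r → CTReq.Active σ CR r' → r.SameMember r' → r = r'
  covered : ∀ p ∈ CR, ∃ r, CTReq.Active σ CR r ∧ (p.1.subst σ).SameMember r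

theorem CTReq.active_singleton {σ : Subst} {r r' : CReq} :
    CTReq.Active σ {(r, ∅)} r' ↔ r.subst σ = r' := by
  simp [CTReq.Active, Cond.Holds, Cond.subst]

theorem CTReq.wellFormed_empty (σ : Subst) : CTReq.WellFormed σ ∅ :=
  ⟨by simp, by simp [CTReq.Active], by simp⟩

theorem CTReq.wellFormed_singleton {σ : Subst} {r : CReq} (hr : r.IsMember) :
    CTReq.WellFormed σ {(r, ∅)} where
  isMember := by simpa using hr
  unique := by
    intro r₁ r₂ h₁ h₂ _
    rw [← CTReq.active_singleton.1 h₁, CTReq.active_singleton.1 h₂]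
  covered := by
    intro p hp
    rw [Finset.mem_singleton] at hp
    subst hp
    exact ⟨_, CTReq.active_singleton.2 rfl, .refl _⟩

theorem Cond.holds_subst_insert {σ : Subst} {a : CondAtom} {c : Cond} :
    (Cond.subst σ (insert a c)).Holds ↔ (a.subst σ).Holds ∧ (c.subst σ).Holds := by
  simp [Cond.Holds, Cond.subst]

theorem Cond.holds_subst_union {σ : Subst} {c c' : Cond} :
    (Cond.subst σ (c ∪ c')).Holds ↔ (c.subst σ).Holds ∧ (c'.subst σ).Holds := by
  simp only [Cond.Holds, Cond.subst, Finset.forall_mem_image, Finset.mem_union, or_imp,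
    forall_and]

theorem mem_mergeCR {CR CR' : CTReq} {p : CReq × Cond} :
    p ∈ (mergeCR CR CR').1 ↔
      (p ∈ CR ∧ ∀ q ∈ CR', p.1.overlap q.1 = false) ∨
      (p ∈ CR' ∧ ∀ q ∈ CR, q.1.overlap p.1 = false) ∨
      ∃ p₁ ∈ CR, ∃ p₂ ∈ CR', p₁.1.overlap p₂.1 = true ∧ p ∈ mergeReqPair p₁ p₂ := by
  simp only [mergeCR, Finset.mem_union, Finset.mem_filter, Finset.mem_biUnion,
    Finset.mem_product, or_assoc]
  refine or_congr_right (or_congr_right ⟨?_, ?_⟩)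
  · rintro ⟨pq, ⟨h₁, h₂⟩, h⟩
    split_ifs at h with ho
    · exact ⟨_, h₁, _, h₂, ho, h⟩
    · simp at h
  · rintro ⟨p₁, h₁, p₂, h₂, ho, h⟩
    exact ⟨(p₁, p₂), ⟨h₁, h₂⟩, by simpa [ho] using h⟩

theorem mem_mergeReqPair {p q x : CReq × Cond} :
    x ∈ mergeReqPair p q ↔ x = (p.1, insert (.ne p.1.recv q.1.recv) p.2) ∨
      x = (q.1, insert (.ne p.1.recv q.1.recv) q.2) ∨
      x = (p.1, insert (.eq p.1.recv q.1.recv) (p.2 ∪ q.2)) := by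
  simp [mergeReqPair]

theorem active_of_active_mergeCR {σ : Subst} {CR CR' : CTReq} {r : CReq}
    (h : CTReq.Active σ (mergeCR CR CR').1 r) :
    CTReq.Active σ CR r ∨ CTReq.Active σ CR' r := by
  obtain ⟨p, hp, hc, rfl⟩ := h
  rcases mem_mergeCR.1 hp with ⟨h₁, -⟩ | ⟨h₂, -⟩ | ⟨p₁, h₁, p₂, h₂, -, hx⟩
  · exact .inl ⟨p, h₁, hc, rfl⟩
  · exact .inr ⟨p, h₂, hc, rfl⟩
  · rcases mem_mergeReqPair.1 hx with rfl | rfl | rfl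
    · exact .inl ⟨p₁, h₁, (Cond.holds_subst_insert.1 hc).2, rfl⟩
    · exact .inr ⟨p₂, h₂, (Cond.holds_subst_insert.1 hc).2, rfl⟩
    · exact .inl ⟨p₁, h₁, (Cond.holds_subst_union.1 (Cond.holds_subst_insert.1 hc).2).1, rfl⟩

theorem exists_mem_of_mem_mergeCR {CR CR' : CTReq} {p : CReq × Cond}
    (hp : p ∈ (mergeCR CR CR').1) :
    (∃ q ∈ CR, q.1 = p.1) ∨ ∃ q ∈ CR', q.1 = p.1 := by
  rcases mem_mergeCR.1 hp with ⟨h₁, -⟩ | ⟨h₂, -⟩ | ⟨p₁, h₁, p₂, h₂, -, hx⟩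
  · exact .inl ⟨p, h₁, rfl⟩
  · exact .inr ⟨p, h₂, rfl⟩
  · rcases mem_mergeReqPair.1 hx with rfl | rfl | rfl
    · exact .inl ⟨p₁, h₁, rfl⟩
    · exact .inr ⟨p₂, h₂, rfl⟩
    · exact .inl ⟨p₁, h₁, rfl⟩

/-- The constraints of a merge force overlapping requirements with equal receivers to agree. -/
theorem subst_eq_of_solves_mergeReqConstraints {Sig : SubclassRel} {σ : Subst} {r r' : CReq}
    (h : Solves Sig (mergeReqConstraints r r') σ)
    (hs : (r.subst σ).SameMember (r'.subst σ)) : r.subst σ = r'.subst σ := by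
  obtain ⟨ho, hr⟩ := hs
  cases r <;> cases r' <;>
    simp_all [CReq.overlap, CReq.subst, CReq.recv, mergeReqConstraints, Solves, Sat, Cond.Holds,
      Cond.subst, CondAtom.subst, CondAtom.Holds]

theorem solves_mergeReqConstraints {Sig : SubclassRel} {σ : Subst} {CR CR' : CTReq}
    (h : Solves Sig (mergeCR CR CR').2 σ) {p q : CReq × Cond} (hp : p ∈ CR) (hq : q ∈ CR')
    (ho : p.1.overlap q.1 = true) : Solves Sig (mergeReqConstraints p.1 q.1) σ :=
  fun s hs => h s (Finset.mem_biUnion.2 ⟨(p, q), Finset.mk_mem_product hp hq, by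
    simpa [ho] using hs⟩)

theorem eq_of_sameMember_of_solves_mergeCR {Sig : SubclassRel} {σ : Subst} {CR CR' : CTReq}
    (h : Solves Sig (mergeCR CR CR').2 σ) {r r' : CReq} (hr : CTReq.Active σ CR r)
    (hr' : CTReq.Active σ CR' r') (hs : r.SameMember r') : r = r' := by
  obtain ⟨p, hp, -, rfl⟩ := hr
  obtain ⟨q, hq, -, rfl⟩ := hr'
  have ho : p.1.overlap q.1 = true := (CReq.overlap_subst σ _ _).symm.trans hs.1
  exact subst_eq_of_solves_mergeReqConstraints (solves_mergeReqConstraints h hp hq ho) hs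

theorem active_mergeCR_of_sameMember {σ : Subst} {CR CR' : CTReq} {r r' : CReq}
    (hr : CTReq.Active σ CR r) (hr' : CTReq.Active σ CR' r') (hs : r.SameMember r') :
    CTReq.Active σ (mergeCR CR CR').1 r := by
  obtain ⟨p, hp, hpc, rfl⟩ := hr
  obtain ⟨q, hq, hqc, rfl⟩ := hr'
  have ho : p.1.overlap q.1 = true := (CReq.overlap_subst σ _ _).symm.trans hs.1
  refine ⟨_, mem_mergeCR.2 (.inr (.inr ⟨p, hp, q, hq, ho,
    mem_mergeReqPair.2 (.inr (.inr rfl))⟩)), ?_, rfl⟩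
  refine Cond.holds_subst_insert.2 ⟨?_, Cond.holds_subst_union.2 ⟨hpc, hqc⟩⟩
  have := hs.2
  rwa [CReq.recv_subst, CReq.recv_subst] at this

theorem active_mergeCR_left {σ : Subst} {CR CR' : CTReq}
    (h' : CR'.WellFormed σ) {r : CReq} (hr : CTReq.Active σ CR r) :
    CTReq.Active σ (mergeCR CR CR').1 r := by
  obtain ⟨p, hp, hpc, rfl⟩ := id hr
  by_cases hn : ∀ q ∈ CR', p.1.overlap q.1 = false
  · exact ⟨p, mem_mergeCR.2 (.inl ⟨hp, hn⟩), hpc, rfl⟩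
  push Not at hn
  obtain ⟨q, hq, ho⟩ := hn
  rw [ne_eq, Bool.not_eq_false] at ho
  by_cases he : p.1.recv.subst σ = q.1.recv.subst σ
  · obtain ⟨r', hr', hs⟩ := h'.covered q hq
    refine active_mergeCR_of_sameMember hr hr' (CReq.SameMember.trans ⟨?_, ?_⟩ hs)
    · rwa [CReq.overlap_subst]
    · rwa [CReq.recv_subst, CReq.recv_subst]
  · exact ⟨_, mem_mergeCR.2 (.inr (.inr ⟨p, hp, q, hq, ho, mem_mergeReqPair.2 (.inl rfl)⟩)),
      Cond.holds_subst_insert.2 ⟨he, hpc⟩, rfl⟩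

theorem active_mergeCR_right {Sig : SubclassRel} {σ : Subst} {CR CR' : CTReq}
    (hS : Solves Sig (mergeCR CR CR').2 σ) (h : CR.WellFormed σ) {r : CReq}
    (hr : CTReq.Active σ CR' r) : CTReq.Active σ (mergeCR CR CR').1 r := by
  obtain ⟨q, hq, hqc, rfl⟩ := id hr
  by_cases hn : ∀ p ∈ CR, p.1.overlap q.1 = false
  · exact ⟨q, mem_mergeCR.2 (.inr (.inl ⟨hq, hn⟩)), hqc, rfl⟩
  push Not at hn
  obtain ⟨p, hp, ho⟩ := hn
  rw [ne_eq, Bool.not_eq_false] at ho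
  by_cases he : p.1.recv.subst σ = q.1.recv.subst σ
  · obtain ⟨r', hr', hs⟩ := h.covered p hp
    have hs' : r'.SameMember (q.1.subst σ) := by
      refine hs.symm.trans ⟨?_, ?_⟩
      · rwa [CReq.overlap_subst]
      · rwa [CReq.recv_subst, CReq.recv_subst]
    have := active_mergeCR_of_sameMember hr' hr hs'
    rwa [eq_of_sameMember_of_solves_mergeCR hS hr' hr hs'] at this
  · exact ⟨_, mem_mergeCR.2 (.inr (.inr ⟨p, hp, q, hq, ho,
      mem_mergeReqPair.2 (.inr (.inl rfl))⟩)), Cond.holds_subst_insert.2 ⟨he, hqc⟩, rfl⟩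

theorem CTReq.WellFormed.mergeCR {Sig : SubclassRel} {σ : Subst} {CR CR' : CTReq}
    (h : CR.WellFormed σ) (h' : CR'.WellFormed σ) (hS : Solves Sig (mergeCR CR CR').2 σ) :
    CTReq.WellFormed σ (CoFJ.mergeCR CR CR').1 where
  isMember p hp := by
    rcases exists_mem_of_mem_mergeCR hp with ⟨q, hq, e⟩ | ⟨q, hq, e⟩
    · exact e ▸ h.isMember q hq
    · exact e ▸ h'.isMember q hq
  unique r r' hr hr' hs := by
    rcases active_of_active_mergeCR hr with hr | hr <;>
      rcases active_of_active_mergeCR hr' with hr' | hr'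
    · exact h.unique r r' hr hr' hs
    · exact eq_of_sameMember_of_solves_mergeCR hS hr hr' hs
    · exact (eq_of_sameMember_of_solves_mergeCR hS hr' hr hs.symm).symm
    · exact h'.unique r r' hr hr' hs
  covered p hp := by
    rcases exists_mem_of_mem_mergeCR hp with ⟨q, hq, e⟩ | ⟨q, hq, e⟩
    · obtain ⟨r, hr, hs⟩ := h.covered q hq
      exact ⟨r, active_mergeCR_left h' hr, e ▸ hs⟩
    · obtain ⟨r, hr, hs⟩ := h'.covered q hq
      exact ⟨r, active_mergeCR_right hS h hr, e ▸ hs⟩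

theorem foldl_mergeCR_subset (CRs : List CTReq) (acc : CTReq × ConstraintSet) :
    acc.2 ⊆ (CRs.foldl (fun acc CR =>
      ((mergeCR acc.1 CR).1, acc.2 ∪ (mergeCR acc.1 CR).2)) acc).2 := by
  induction CRs generalizing acc with
  | nil => exact subset_rfl
  | cons CR CRs ih =>
    exact Finset.subset_union_left.trans
      (ih ((mergeCR acc.1 CR).1, acc.2 ∪ (mergeCR acc.1 CR).2))

theorem foldl_mergeCR_wellFormed {Sig : SubclassRel} {σ : Subst} {CRs : List CTReq}
    {acc : CTReq × ConstraintSet} (hacc : acc.1.WellFormed σ)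
    (hCRs : ∀ CR ∈ CRs, CTReq.WellFormed σ CR)
    (h : Solves Sig (CRs.foldl (fun acc CR =>
      ((mergeCR acc.1 CR).1, acc.2 ∪ (mergeCR acc.1 CR).2)) acc).2 σ) :
    CTReq.WellFormed σ (CRs.foldl (fun acc CR =>
      ((mergeCR acc.1 CR).1, acc.2 ∪ (mergeCR acc.1 CR).2)) acc).1 ∧
    ∀ CR ∈ acc.1 :: CRs, ∀ r, CTReq.Active σ CR r → CTReq.Active σ (CRs.foldl (fun acc CR =>
      ((mergeCR acc.1 CR).1, acc.2 ∪ (mergeCR acc.1 CR).2)) acc).1 r := by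
  induction CRs generalizing acc with
  | nil => exact ⟨hacc, by simp⟩
  | cons CR CRs ih =>
    have hS := (solves_union.1 (h.mono (foldl_mergeCR_subset CRs
      ((mergeCR acc.1 CR).1, acc.2 ∪ (mergeCR acc.1 CR).2)))).2
    have hCR := hCRs CR List.mem_cons_self
    obtain ⟨hw, ha⟩ := ih (acc := ((mergeCR acc.1 CR).1, acc.2 ∪ (mergeCR acc.1 CR).2))
      (hacc.mergeCR hCR hS) (fun CR' h' => hCRs CR' (List.mem_cons_of_mem _ h')) h
    have hm := ha _ List.mem_cons_self
    refine ⟨hw, fun CR' hCR' r hr => ?_⟩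
    rcases List.mem_cons.1 hCR' with rfl | hCR'
    · exact hm r (active_mergeCR_left hCR hr)
    rcases List.mem_cons.1 hCR' with rfl | hCR'
    · exact hm r (active_mergeCR_right hS hacc hr)
    · exact ha CR' (List.mem_cons_of_mem _ hCR') r hr

theorem mergeCRs_wellFormed {Sig : SubclassRel} {σ : Subst} {CRs : List CTReq}
    (hCRs : ∀ CR ∈ CRs, CTReq.WellFormed σ CR) (h : Solves Sig (mergeCRs CRs).2 σ) :
    CTReq.WellFormed σ (mergeCRs CRs).1 :=
  (foldl_mergeCR_wellFormed (CTReq.wellFormed_empty σ) hCRs h).1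

theorem active_mergeCRs {Sig : SubclassRel} {σ : Subst} {CRs : List CTReq}
    (hCRs : ∀ CR ∈ CRs, CTReq.WellFormed σ CR) (h : Solves Sig (mergeCRs CRs).2 σ)
    {CR : CTReq} (hCR : CR ∈ CRs) {r : CReq} (hr : CTReq.Active σ CR r) :
    CTReq.Active σ (mergeCRs CRs).1 r :=
  (foldl_mergeCR_wellFormed (CTReq.wellFormed_empty σ) hCRs h).2 CR
    (List.mem_cons_of_mem _ hCR) r hr

/-! ### Invariants of co-contextual derivations -/

mutual

theorem CoType.functional {F : Finset CVar} {e : Expr} {T : Ty} {S : ConstraintSet}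
    {R : CtxReq} {CR : CTReq} : CoType F e T S R CR → R.Functional
  | .var => by simp [CtxReq.Functional]
  | .field h _ _ => h.functional
  | .invk h hs _ _ _ _ hR _ => by
    obtain ⟨rfl, -⟩ := Prod.ext_iff.1 hR
    exact mergeRs_functional (List.forall_mem_cons.2 ⟨h.functional, hs.functional⟩)
  | .new hs _ _ _ hR _ => by
    obtain ⟨rfl, -⟩ := Prod.ext_iff.1 hR
    exact mergeRs_functional hs.functional
  | .ucast h => h.functional
  | .dcast h => h.functional
  | .scast h => h.functional

theorem CoTypes.functional {F : Finset CVar} {es : List Expr} {Ts : List Ty}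
    {S : ConstraintSet} {Rs : List CtxReq} {CRs : List CTReq} :
    CoTypes F es Ts S Rs CRs → ∀ R ∈ Rs, CtxReq.Functional R
  | .nil => by simp
  | .cons h hs _ => List.forall_mem_cons.2 ⟨h.functional, hs.functional⟩

end

mutual

theorem CoType.wellFormed {Sig : SubclassRel} {σ : Subst} {F : Finset CVar} {e : Expr} {T : Ty}
    {S : ConstraintSet} {R : CtxReq} {CR : CTReq} :
    CoType F e T S R CR → Solves Sig S σ → CR.WellFormed σ
  | .var, _ => CTReq.wellFormed_empty σ
  | .field h _ hCR, hS => by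
    obtain ⟨rfl, rfl⟩ := Prod.ext_iff.1 hCR
    obtain ⟨hSe, hSf⟩ := solves_union.1 hS
    exact (h.wellFormed hSe).mergeCR (CTReq.wellFormed_singleton trivial) hSf
  | .invk h hs _ _ _ _ _ hCR, hS => by
    obtain ⟨rfl, rfl⟩ := Prod.ext_iff.1 hCR
    simp only [solves_union] at hS
    obtain ⟨⟨⟨⟨hSs, hSe⟩, -⟩, -⟩, hScr⟩ := hS
    exact mergeCRs_wellFormed (List.forall_mem_cons.2 ⟨h.wellFormed hSe,
      List.forall_mem_cons.2 ⟨CTReq.wellFormed_singleton trivial, hs.wellFormed hSs⟩⟩) hScr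
  | .new hs _ _ _ _ hCR, hS => by
    obtain ⟨rfl, rfl⟩ := Prod.ext_iff.1 hCR
    simp only [solves_union] at hS
    obtain ⟨⟨⟨hSs, -⟩, -⟩, hScr⟩ := hS
    exact mergeCRs_wellFormed
      (List.forall_mem_cons.2 ⟨CTReq.wellFormed_singleton trivial, hs.wellFormed hSs⟩) hScr
  | .ucast h, hS => h.wellFormed (solves_union.1 hS).1
  | .dcast h, hS => h.wellFormed (solves_union.1 (solves_union.1 hS).1).1
  | .scast h, hS => h.wellFormed (solves_union.1 (solves_union.1 hS).1).1

theorem CoTypes.wellFormed {Sig : SubclassRel} {σ : Subst} {F : Finset CVar} {es : List Expr}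
    {Ts : List Ty} {S : ConstraintSet} {Rs : List CtxReq} {CRs : List CTReq} :
    CoTypes F es Ts S Rs CRs → Solves Sig S σ → ∀ CR ∈ CRs, CTReq.WellFormed σ CR
  | .nil, _ => by simp
  | .cons h hs _, hS => List.forall_mem_cons.2
      ⟨h.wellFormed (solves_union.1 hS).1, hs.wellFormed (solves_union.1 hS).2⟩

end

/-! ### Typing from satisfied requirements -/

theorem Ty.subst_cls (σ : Subst) (C : ClassName) : (Ty.cls C).subst σ = .cls C := rfl

theorem tySubtype_cls {Sig : SubclassRel} {C D : ClassName} :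
    TySubtype Sig (.cls C) (.cls D) ↔ IsSubtype Sig C D := by
  simp [TySubtype]

theorem forall₂_isSubtype_of_solves {Sig : SubclassRel} {σ : Subst} {Ts : List Ty}
    {Us : List CVar} {Cs Ds : List ClassName} (hS : Solves Sig (subConstraints Ts Us) σ)
    (hlen : Us.length = Cs.length) (hC : Ts.map (Ty.subst σ) = Cs.map Ty.cls)
    (hD : (Us.map Ty.var).map (Ty.subst σ) = Ds.map Ty.cls) :
    List.Forall₂ (IsSubtype Sig) Cs Ds := by
  induction Cs generalizing Ts Us Ds with
  | nil =>
    obtain rfl := List.length_eq_zero_iff.1 hlen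
    simp only [List.map_nil, List.nil_eq, List.map_eq_nil_iff] at hD
    rw [hD]
    exact .nil
  | cons C Cs ih =>
    obtain ⟨T, Ts, rfl, hT, hTs⟩ := List.map_eq_cons_iff.1 hC
    obtain ⟨U, Us, rfl⟩ := List.exists_cons_of_length_eq_add_one hlen
    obtain ⟨D, Ds, rfl, hU, hUs⟩ := List.map_eq_cons_iff.1 hD.symm
    have hsub := hS (.sub T (.var U)) (by simp [subConstraints])
    simp only [Sat, hT, ← hU, tySubtype_cls] at hsub
    refine .cons hsub (ih (hS.mono ?_) (by simpa using hlen) hTs hUs.symm)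
    intro s hs
    simp only [subConstraints, List.mem_toFinset, List.zipWith_cons_cons, List.mem_cons] at hs ⊢
    exact .inr hs

theorem HasTypes.length_eq {Γ : Ctx} {CT : ClassTable} {es : List Expr} {Cs : List ClassName}
    (h : HasTypes Γ CT es Cs) : es.length = Cs.length := by
  induction es generalizing Cs with
  | nil => cases h; rfl
  | cons e es ih => cases h with | cons _ h => simp [ih h]

theorem SatisfiesReq.field_inv {CT : ClassTable} {C : ClassName} {f : FieldName} {T : Ty}
    (h : SatisfiesReq CT (.field (.cls C) f T)) :
    ∃ D, T = .cls D ∧ FieldLookup CT f C D := by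
  cases h with | field h => exact ⟨_, rfl, h⟩

theorem SatisfiesReq.method_inv {CT : ClassTable} {C : ClassName} {m : MethodName}
    {Ts : List Ty} {T : Ty} (h : SatisfiesReq CT (.method (.cls C) m Ts T)) :
    ∃ Ds D, Ts = Ds.map Ty.cls ∧ T = .cls D ∧ MType CT m C Ds D := by
  generalize hr : CReq.method (.cls C) m Ts T = r at h
  cases h <;> cases hr
  exact ⟨_, _, rfl, rfl, ‹_›⟩

theorem SatisfiesReq.ctor_inv {CT : ClassTable} {C : ClassName} {Ts : List Ty}
    (h : SatisfiesReq CT (.ctor (.cls C) Ts)) :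
    ∃ Ds, Ts = Ds.map Ty.cls ∧ Fields CT C Ds := by
  generalize hr : CReq.ctor (.cls C) Ts = r at h
  cases h <;> cases hr
  exact ⟨_, rfl, ‹_›⟩

mutual

theorem CoType.hasType {σ : Subst} {Γ : Ctx} {CT : ClassTable} {F : Finset CVar} {e : Expr}
    {T : Ty} {S : ConstraintSet} {R : CtxReq} {CR : CTReq} :
    CoType F e T S R CR → Solves CT.extRel S σ → R.subst σ ⊆ Γ.toReq →
    (∀ r, CR.Active σ r → SatisfiesReq CT r) →
    ∃ C, T.subst σ = .cls C ∧ HasType Γ CT e C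
  | .var (x := x) (U := U), _, hΓ, _ => by
    have := hΓ (Finset.mem_image_of_mem _ (Finset.mem_singleton_self (x, Ty.var U)))
    obtain ⟨b, hb, e⟩ := Finset.mem_image.1 this
    obtain ⟨rfl, hU⟩ := Prod.ext_iff.1 e
    exact ⟨b.2, hU.symm, .var hb⟩
  | .field (f := f) (Te := Te) (U := U) h _ hCR, hS, hΓ, hCT => by
    obtain ⟨rfl, rfl⟩ := Prod.ext_iff.1 hCR
    obtain ⟨hSe, hSf⟩ := solves_union.1 hS
    obtain ⟨Ce, hTe, he⟩ := h.hasType hSe hΓ fun r hr =>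
      hCT r (active_mergeCR_left
        (CTReq.wellFormed_singleton (r := .field Te f (.var U)) trivial) hr)
    have hf := hCT _ (active_mergeCR_right hSf (h.wellFormed hSe)
      (CTReq.active_singleton.2 rfl))
    simp only [CReq.subst, hTe] at hf
    obtain ⟨D, hU, hf⟩ := hf.field_inv
    exact ⟨D, hU, .field he hf⟩
  | .invk (m := m) (Te := Te) (U := U) (Us := Us) h hs _ hlen _ _ hR hCR, hS, hΓ, hCT => by
    obtain ⟨rfl, rfl⟩ := Prod.ext_iff.1 hCR
    obtain ⟨rfl, rfl⟩ := Prod.ext_iff.1 hR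
    simp only [solves_union] at hS
    obtain ⟨⟨⟨⟨hSs, hSe⟩, hsub⟩, hSr⟩, hScr⟩ := hS
    have hR := subset_mergeRs hSr
    have hw := List.forall_mem_cons.2 ⟨h.wellFormed hSe, List.forall_mem_cons.2
      ⟨CTReq.wellFormed_singleton (r := .method Te m (Us.map Ty.var) (.var U)) trivial,
        hs.wellFormed hSs⟩⟩
    obtain ⟨Ce, hTe, he⟩ := h.hasType hSe ((hR _ List.mem_cons_self).trans hΓ) fun r hr =>
      hCT r (active_mergeCRs hw hScr List.mem_cons_self hr)
    obtain ⟨Cs, hTs, hes⟩ := hs.hasTypes hSs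
      (fun R hR' => (hR R (List.mem_cons_of_mem _ hR')).trans hΓ) fun CR hCR r hr =>
        hCT r (active_mergeCRs hw hScr (List.mem_cons_of_mem _ (List.mem_cons_of_mem _ hCR)) hr)
    have hm := hCT _ (active_mergeCRs hw hScr (List.mem_cons_of_mem _ List.mem_cons_self)
      (CTReq.active_singleton.2 rfl))
    simp only [CReq.subst, hTe] at hm
    obtain ⟨Ds, D, hUs, hU, hm⟩ := hm.method_inv
    exact ⟨D, hU, .invk he hes hm
      (forall₂_isSubtype_of_solves hsub (hlen.trans hes.length_eq) hTs hUs)⟩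
  | .new (C := C) (Us := Us) hs hlen _ _ hR hCR, hS, hΓ, hCT => by
    obtain ⟨rfl, rfl⟩ := Prod.ext_iff.1 hCR
    obtain ⟨rfl, rfl⟩ := Prod.ext_iff.1 hR
    simp only [solves_union] at hS
    obtain ⟨⟨⟨hSs, hsub⟩, hSr⟩, hScr⟩ := hS
    have hR := subset_mergeRs hSr
    have hw := List.forall_mem_cons.2
      ⟨CTReq.wellFormed_singleton (r := .ctor (.cls C) (Us.map Ty.var)) trivial,
        hs.wellFormed hSs⟩
    obtain ⟨Cs, hTs, hes⟩ := hs.hasTypes hSs (fun R hR' => (hR R hR').trans hΓ)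
      fun CR hCR r hr => hCT r (active_mergeCRs hw hScr (List.mem_cons_of_mem _ hCR) hr)
    have hc := hCT _ (active_mergeCRs hw hScr List.mem_cons_self
      (CTReq.active_singleton.2 rfl))
    obtain ⟨Ds, hUs, hc⟩ := SatisfiesReq.ctor_inv hc
    exact ⟨C, rfl, .new hes hc
      (forall₂_isSubtype_of_solves hsub (hlen.trans hes.length_eq) hTs hUs)⟩
  | .ucast (C := C) h, hS, hΓ, hCT => by
    obtain ⟨hSe, hsub⟩ := solves_union.1 hS
    obtain ⟨D, hTe, he⟩ := h.hasType hSe hΓ hCT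
    have hsub := hsub _ (Finset.mem_singleton_self _)
    simp only [Sat, hTe, Ty.subst_cls, tySubtype_cls] at hsub
    exact ⟨C, rfl, .ucast he hsub⟩
  | .dcast (C := C) h, hS, hΓ, hCT => by
    simp only [solves_union] at hS
    obtain ⟨⟨hSe, hsub⟩, hne⟩ := hS
    obtain ⟨D, hTe, he⟩ := h.hasType hSe hΓ hCT
    have hsub := hsub _ (Finset.mem_singleton_self _)
    have hne := hne _ (Finset.mem_singleton_self _)
    simp only [Sat, hTe, Ty.subst_cls, tySubtype_cls, ne_eq, Ty.cls.injEq] at hsub hne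
    exact ⟨C, rfl, .dcast he hsub hne⟩
  | .scast (C := C) h, hS, hΓ, hCT => by
    simp only [solves_union] at hS
    obtain ⟨⟨hSe, hsub⟩, hsub'⟩ := hS
    obtain ⟨D, hTe, he⟩ := h.hasType hSe hΓ hCT
    have hsub := hsub _ (Finset.mem_singleton_self _)
    have hsub' := hsub' _ (Finset.mem_singleton_self _)
    simp only [Sat, hTe, Ty.subst_cls, tySubtype_cls] at hsub hsub'
    exact ⟨C, rfl, .scast he hsub hsub'⟩

theorem CoTypes.hasTypes {σ : Subst} {Γ : Ctx} {CT : ClassTable} {F : Finset CVar}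
    {es : List Expr} {Ts : List Ty} {S : ConstraintSet} {Rs : List CtxReq}
    {CRs : List CTReq} :
    CoTypes F es Ts S Rs CRs → Solves CT.extRel S σ →
    (∀ R ∈ Rs, CtxReq.subst σ R ⊆ Γ.toReq) →
    (∀ CR ∈ CRs, ∀ r, CTReq.Active σ CR r → SatisfiesReq CT r) →
    ∃ Cs, Ts.map (Ty.subst σ) = Cs.map Ty.cls ∧ HasTypes Γ CT es Cs
  | .nil, _, _, _ => ⟨[], rfl, .nil⟩
  | .cons h hs _, hS, hΓ, hCT => by
    obtain ⟨hS₁, hS₂⟩ := solves_union.1 hS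
    obtain ⟨C, hT, he⟩ := h.hasType hS₁ (hΓ _ List.mem_cons_self) (hCT _ List.mem_cons_self)
    obtain ⟨Cs, hTs, hes⟩ := hs.hasTypes hS₂
      (fun R hR => hΓ R (List.mem_cons_of_mem _ hR))
      fun CR hCR => hCT CR (List.mem_cons_of_mem _ hCR)
    exact ⟨C :: Cs, by simp [hT, hTs], .cons he hes⟩

end

/-! ### The typing context and the class table of a ground solution -/

theorem CtxReq.Functional.exists_ctx {σ : Subst} {R : CtxReq} (hR : R.Functional)
    (hg : CtxReq.Ground (R.subst σ)) : ∃ Γ : Ctx, R.subst σ ⊆ Γ.toReq := by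
  have hinj : Function.Injective fun b : Var × ClassName => (b.1, Ty.cls b.2) := by
    rintro ⟨x, C⟩ ⟨y, D⟩ h
    simpa using h
  refine ⟨⟨(R.subst σ).preimage _ hinj.injOn, ?_⟩, ?_⟩
  · intro x C D hC hD
    obtain ⟨b, hb, hbC⟩ := Finset.mem_image.1 (Finset.mem_preimage.1 hC)
    obtain ⟨d, hd, hdD⟩ := Finset.mem_image.1 (Finset.mem_preimage.1 hD)
    obtain ⟨h₁, h₂⟩ := Prod.ext_iff.1 hbC
    obtain ⟨h₃, h₄⟩ := Prod.ext_iff.1 hdD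
    obtain rfl := hR b hb d hd (h₁.trans h₃.symm)
    exact Ty.cls.inj (h₂.symm.trans h₄)
  · intro b hb
    obtain ⟨C, hC⟩ := hg b hb
    have hbC : (b.1, Ty.cls C) = b := Prod.ext rfl hC.symm
    refine Finset.mem_image.2 ⟨(b.1, C), ?_, hbC⟩
    rw [Finset.mem_preimage, hbC]
    exact hb

theorem Ty.cls_injective : Function.Injective Ty.cls := fun _ _ => Ty.cls.inj

theorem Clause.toReq_injective : Function.Injective Clause.toReq := by
  intro c c' h
  cases c <;> cases c' <;>
    simp_all [Clause.toReq, (List.map_injective_iff.2 Ty.cls_injective).eq_iff]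

theorem exists_map_cls {Ts : List Ty} (h : ∀ T ∈ Ts, T.Ground) :
    ∃ Cs : List ClassName, Cs.map Ty.cls = Ts := by
  induction Ts with
  | nil => exact ⟨[], rfl⟩
  | cons T Ts ih =>
    obtain ⟨⟨C, rfl⟩, hTs⟩ := List.forall_mem_cons.1 h
    obtain ⟨Cs, rfl⟩ := ih hTs
    exact ⟨C :: Cs, rfl⟩

theorem CReq.IsMember.exists_toReq {r : CReq} (h : r.IsMember) (hg : r.Ground) :
    ∃ c : Clause, c.toReq = r := by
  cases r with
  | ext => exact h.elim
  | optMethod => exact h.elim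
  | ctor T Ts =>
    obtain ⟨⟨C, rfl⟩, hTs⟩ := hg
    obtain ⟨Cs, rfl⟩ := exists_map_cls hTs
    exact ⟨.ctor C Cs, rfl⟩
  | field T f T' =>
    obtain ⟨⟨C, rfl⟩, ⟨D, rfl⟩⟩ := hg
    exact ⟨.field C f D, rfl⟩
  | method T m Ts T' =>
    obtain ⟨⟨C, rfl⟩, hTs, ⟨D, rfl⟩⟩ := hg
    obtain ⟨Cs, rfl⟩ := exists_map_cls hTs
    exact ⟨.method C m Cs D, rfl⟩

theorem satisfiesReq_toReq {CT : ClassTable} {c : Clause} (hc : c ∈ CT) :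
    c.toReq.IsMember → SatisfiesReq CT c.toReq := by
  intro h
  cases c with
  | ext => exact h.elim
  | ctor => exact .ctor hc
  | field => exact .field (.here hc)
  | method => exact .method (.here hc)

theorem Clause.sameMember_toReq {c c' : Clause} (h : c.dom = c'.dom) :
    c.toReq.SameMember c'.toReq := by
  cases c <;> cases c' <;>
    simp_all [Clause.dom, Clause.toReq, CReq.SameMember, CReq.overlap, CReq.recv]

theorem mem_extRel {CT : ClassTable} {p : ClassName × ClassName} :
    p ∈ CT.extRel ↔ Clause.ext p.1 p.2 ∈ CT := by
  simp only [ClassTable.extRel, Finset.mem_biUnion]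
  constructor
  · rintro ⟨c, hc, h⟩
    cases c <;> simp at h
    subst h
    exact hc
  · exact fun h => ⟨_, h, by simp⟩

/-- The active requirements of a ground solution are the clauses of a class table. -/
theorem CTReq.WellFormed.exists_classTable {σ : Subst} {CR : CTReq} (h : CR.WellFormed σ)
    (hg : CTReq.Ground (CR.subst σ)) (Sig : SubclassRel) :
    ∃ CT : ClassTable, CT.extRel = Sig ∧ CT.Coherent ∧ CT.BuiltFrom Sig (CR.subst σ) ∧
      ∀ r, CR.Active σ r → SatisfiesReq CT r := by
  classical
  have hmem : ∀ r, CR.Active σ r → r.IsMember := by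
    rintro _ ⟨p, hp, -, rfl⟩
    exact (h.isMember p hp).subst σ
  let A : Finset CReq := (CR.filter fun p => (p.2.subst σ).Holds).image fun p => p.1.subst σ
  have hA : ∀ r, r ∈ A ↔ CR.Active σ r := by
    intro r
    simp [A, CTReq.Active, and_assoc]
  let CT : ClassTable := Sig.image (fun p => Clause.ext p.1 p.2) ∪
    A.preimage Clause.toReq Clause.toReq_injective.injOn
  have hCT : ∀ c, c ∈ CT ↔ (∃ p ∈ Sig, c = .ext p.1 p.2) ∨ CR.Active σ c.toReq := by
    intro c
    simp only [CT, Finset.mem_union, Finset.mem_image, Finset.mem_preimage, hA, eq_comm]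
  refine ⟨CT, ?_, ?_, ?_, ?_⟩
  · ext p
    rw [mem_extRel, hCT]
    constructor
    · rintro (⟨q, hq, e⟩ | ha)
      · obtain ⟨h₁, h₂⟩ := Clause.ext.inj e
        rwa [Prod.ext h₁ h₂]
      · exact (hmem _ ha).elim
    · exact fun hp => .inl ⟨p, hp, rfl⟩
  · intro c hc c' hc' hne hdom
    have key : ∀ d ∈ CT, d.dom = c.dom → CR.Active σ d.toReq := by
      intro d hd he
      rcases (hCT d).1 hd with ⟨p, -, rfl⟩ | ha
      · exact absurd he.symm (hne p.1)
      · exact ha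
    exact Clause.toReq_injective
      (h.unique _ _ (key c hc rfl) (key c' hc' hdom.symm) (Clause.sameMember_toReq hdom))
  · intro c hc
    refine ((hCT c).1 hc).imp_right ?_
    rintro ⟨p, hp, -, e⟩
    exact ⟨_, Finset.mem_image_of_mem _ hp, e⟩
  · intro r hr
    have hgr : r.Ground := by
      obtain ⟨p, hp, -, rfl⟩ := hr
      exact (hg _ (Finset.mem_image_of_mem _ hp)).1
    obtain ⟨c, rfl⟩ := (hmem r hr).exists_toReq hgr
    exact satisfiesReq_toReq ((hCT c).2 (.inr hr)) (hmem _ hr)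

end CoFJ

theorem mainTheorem2 (e : Expr) (T : Ty) (S : ConstraintSet) (R : CtxReq) (CR : CTReq)
    (Sig : SubclassRel) (σ : Subst)
    (hty : CoTyping e T S R CR) (hsolve : Solves Sig S σ) (hground : GroundSolution σ T R CR) :
    ∃ (C : ClassName) (Γ : Ctx) (CT : ClassTable),
      HasType Γ CT e C ∧ Corresponds C Γ CT σ T R CR ∧ CT.extRel = Sig ∧
        CT.Coherent ∧ CT.BuiltFrom Sig (CR.subst σ) := by
  obtain ⟨F, hF⟩ := hty
  obtain ⟨-, hgR, hgCR⟩ := hground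
  obtain ⟨Γ, hΓ⟩ := hF.functional.exists_ctx hgR
  obtain ⟨CT, rfl, hcoh, hbuilt, hCT⟩ := (hF.wellFormed hsolve).exists_classTable hgCR Sig
  obtain ⟨C, hC, he⟩ := hF.hasType hsolve hΓ hCT
  refine ⟨C, Γ, CT, he, ⟨hC.symm, hΓ, ?_⟩, rfl, hcoh, hbuilt⟩
  intro q hq hc
  obtain ⟨p, hp, rfl⟩ := Finset.mem_image.1 hq
  exact hCT _ ⟨p, hp, hc, rfl⟩
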